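/- Let $T>0$ and let $V,H$ be (real) Hilbert spaces with $V$ compactly embedded in $H$. For every $N\in\mathbb N$, $N\ge 1$, put $\Delta t=T/N$, and for $n=1,\dots,N$ let $V^n_{\Delta t}$ and $Q^n_{\Delta t}$ be Hilbert spaces continuously embedded in $V$, with embedding constants independent of $\Delta t$ and $n$, such that $V^n_{\Delta t}\subset\subset\overline{Q^n_{\Delta t}}^{H}\hookrightarrow (Q^n_{\Delta t})'$. Elements of all these spaces are identified with their images in $V$ and in $H$, and an element $w\in H$ acts on a space $Q$ that is continuously embedded in $H$ by $q\mapsto (w,q)_H$, so that $\|w\|_{Q'}=\sup\{|(w,q)_H| : q\in Q,\ \|q\|_{Q}\le 1\}$. Let $u^n_{\Delta t}\in V^n_{\Delta t}$ for $n=1,\dots,N$, and let $u_{\Delta t}\in L^2(0,T;H)$ be the piecewise constant function with $u_{\Delta t}=u^n_{\Delta t}$ on $((n-1)\Delta t,n\Delta t]$, $n=1,\dots,N$. Suppose that the following conditions hold, with constants $C>0$ that do not depend on $\Delta t$, $n$, $l$. (A1) $\sum_{n=1}^N\|u^n_{\Delta t}\|^2_{V^n_{\Delta t}}\Delta t\le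 C$ for every $\Delta t$. (A2) $\|u_{\Delta t}\|_{L^\infty(0,T;H)}\le C$ for every $\Delta t$. (B) $\big\|P^n_{\Delta t}\frac{u^{n+1}_{\Delta t}-u^n_{\Delta t}}{\Delta t}\big\|_{(Q^n_{\Delta t})'}\le C\big(\|u^{n+1}_{\Delta t}\|_{V^{n+1}_{\Delta t}}+1\big)$ for $n=1,\dots,N-1$, where $P^n_{\Delta t}$ is the orthogonal projector of $H$ onto $\overline{Q^n_{\Delta t}}^{H}$. (C1) For every $\Delta t$, $l\in\{1,\dots,N\}$ and $n\in\{1,\dots,N-l\}$ there are a normed space $Q^{n,l}_{\Delta t}$ continuously embedded in $V$ and maps $J^i_{\Delta t,l,n}:Q^{n,l}_{\Delta t}\to Q^{n+i}_{\Delta t}$, $i=0,\dots,l$, such that for all $q\in Q^{n,l}_{\Delta t}$ $$\|J^i_{\Delta t,l,n}q\|_{Q^{n+i}_{\Delta t}}\le C\|q\|_{Q^{n,l}_{\Delta t}},\qquad \|J^i_{\Delta t,l,n}q-q\|_H\le C\sqrt{l\Delta t}\,\|q\|_{Q^{n,l}_{\Delta t}},\qquad i\in\{0,\dots,l\},$$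 $$\big(J^{j+1}_{\Delta t,l,n}q-J^{j}_{\Delta t,l,n}q,\;u^{n+j+1}_{\Delta t}\big)_H\le C\,\Delta t\,\|q\|_{Q^{n,l}_{\Delta t}}\|u^{n+j+1}_{\Delta t}\|_{V^{n+j+1}_{\Delta t}},\qquad j\in\{0,\dots,l-1\}.$$ (C2) Let $V^{n,l}_{\Delta t}=\overline{Q^{n,l}_{\Delta t}}^{V}$, with the norm of $V$. There are maps $I^i_{\Delta t,l,n}:V^{n+i}_{\Delta t}\to V^{n,l}_{\Delta t}$, $i=0,\dots,l$, and a monotonically increasing function $g:\mathbb R_+\to\mathbb R_+$, independent of $\Delta t,n,l$, with $g(h)\to0$ as $h\to0$, such that for all $v\in V^{n+i}_{\Delta t}$ and $i\in\{0,\dots,l\}$ $$\|I^i_{\Delta t,l,n}v\|_{V^{n,l}_{\Delta t}}\le C\|v\|_{V^{n+i}_{\Delta t}},\qquad \|I^i_{\Delta t,l,n}v-v\|_H\le g(l\Delta t)\|v\|_{V^{n+i}_{\Delta t}}.$$ (C3) For every $\delta>0$ there is a constant $C(\delta)>0$, independent of $n$, $l$ and $\Delta t$, such that $$\|v\|_H\le\delta\|v\|_{V^{n,l}_{\Delta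 t}}+C(\delta)\|v\|_{(Q^{n,l}_{\Delta t})'}\qquad\text{for all } v\in V^{n,l}_{\Delta t}.$$ Then the family $\{u_{\Delta t} : \Delta t=T/N,\ N\ge1\}$ is relatively compact in $L^2(0,T;H)$. (No numerical dissipation bound $\|u_{\Delta t}(\cdot-\Delta t)-u_{\Delta t}\|^2_{L^2(\Delta t,T;H)}\le C\Delta t$ is assumed.) -/

import Mathlib

open Set Filter Topology MeasureTheory
open scoped ENNReal

noncomputable section

/-- The closure in `Y` of (the image of) a space `X` that is embedded in `Y` by `e`. -/
def closureIn {X Y : Type*} [NormedAddCommGroup X] [NormedSpace ℝ X]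
    [NormedAddCommGroup Y] [NormedSpace ℝ Y] (e : X →L[ℝ] Y) : Submodule ℝ Y :=
  (LinearMap.range (e : X →ₗ[ℝ] Y)).topologicalClosure

/-- The `H`-orthogonal projector onto the closure in `H` of a space `Q` that is embedded in `H`
by `j`, with values in `H`. -/
def projOnClosure {Q H : Type*} [NormedAddCommGroup Q] [NormedSpace ℝ Q]
    [NormedAddCommGroup H] [InnerProductSpace ℝ H] [CompleteSpace H] (j : Q →L[ℝ] H) :
    H →L[ℝ] H :=
  (LinearMap.range (j : Q →ₗ[ℝ] H)).topologicalClosure.starProjection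

/-- The norm in the dual `Q'` of an element `w` of `H`, where `Q` is embedded in `H` by `j` and
`w` acts on `Q` through the scalar product of `H`: the operator norm of `q ↦ (w, j q)_H`. -/
def dualNorm {Q H : Type*} [NormedAddCommGroup Q] [NormedSpace ℝ Q]
    [NormedAddCommGroup H] [InnerProductSpace ℝ H] (j : Q →L[ℝ] H) (w : H) : ℝ :=
  ‖(innerSL ℝ w).comp j‖

/-- The Bochner space `L²(0,T;H)`. -/
abbrev BochnerL2 (T : ℝ) (H : Type*) [NormedAddCommGroup H] :=
  Lp H 2 (volume.restrict (Ioo (0 : ℝ) T))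

end

/-!
The proof bounds time translates and then applies a discrete Kolmogorov–Simon criterion.

*Translates.* Write `y n` for the image of `u^n_Δt` in `H` and `h = l Δt`. An element `q` of
`Q^{n,l}_Δt` is not an admissible test function for the single increments `y (n+j+1) - y (n+j)`, but
`J^j q` is one. Summation by parts (`inner_sub_le_of_increments`) expresses
`(y (n+l) - y n, q)_H` through the increments tested with `J^j q`, which `hB` controls, the differences
`J^{j+1} q - J^j q` tested with `y (n+j+1)`, and two end terms with `J^i q - q`, the last two being
controlled by `hC1` and `hA2`. With the Cauchy–Schwarz inequality and `hA1` this gives a bound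
`M √h ‖q‖`. The maps `I^i` (`hC21`, `hC22`) move `y (n+l)` and `y n` into the common space `V^{n,l}_Δt` at the price
of `g h`, where the uniform Ehrling inequality `hC3` applies: for every `δ > 0`,
`‖y (n+l) - y n‖ ≤ (C (1 + C_δ) g h + C δ) (‖u^{n+l}‖ + ‖u^n‖) + C C_δ √h`.
Its square, summed over `n` with weight `Δt`, is small uniformly in `Δt` once `δ` and then `h` are
small.

*Compactness* (`isCompact_closure_of_sum_translate_le`). Fix a coarse grid of `K` cells. For `N ≥ K`
the function `u_Δt` is compared with its averages over the coarse cells. The averages are bounded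
in `V` in terms of `K`, so that the averaged functions lie in the image of a compact product of subsets
of `H`; the error is bounded by translates over at most `T/K + T/N` (`sum_sq_sub_blockAvg_le`). The
finitely many remaining functions form a compact set. The grids with `N` and with `K` cells have the
common refinement with `N * K` cells, on which all functions involved are step functions and all norms
are finite sums.
-/

/-! ### Averages over blocks of a finite sequence -/

/-- Each `i < N` is the quotient `m / K` of exactly `K` numbers `m < N * K`. -/
theorem sum_range_mul_div (N K : ℕ) (hK : 0 < K) (ψ : ℕ → ℝ) :
    ∑ m ∈ Finset.range (N * K), ψ (m / K) = K * ∑ i ∈ Finset.range N, ψ i := by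
  induction N with
  | zero => simp
  | succ N ih =>
    rw [Nat.succ_mul, Finset.sum_range_add, ih, Finset.sum_range_succ, mul_add]
    congr 1
    rw [Finset.sum_congr rfl (g := fun _ => ψ N), Finset.sum_const, Finset.card_range,
      nsmul_eq_mul]
    intro r hr
    rw [Nat.mul_comm N K, Nat.mul_add_div hK, Nat.div_eq_of_lt (Finset.mem_range.1 hr), add_zero]

/-- Jensen's inequality for the square of the norm and the uniform average. -/
theorem norm_sub_avg_sq_le {H : Type*} [NormedAddCommGroup H] [NormedSpace ℝ H]
    {κ : Type*} (s : Finset κ) (hs : s.Nonempty) (v : κ → H) (x : H) :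
    ‖x - (s.card : ℝ)⁻¹ • ∑ m ∈ s, v m‖ ^ 2 ≤ (s.card : ℝ)⁻¹ * ∑ m ∈ s, ‖x - v m‖ ^ 2 := by
  have hc : (0 : ℝ) < s.card := by exact_mod_cast hs.card_pos
  have h1 : x - (s.card : ℝ)⁻¹ • ∑ m ∈ s, v m = (s.card : ℝ)⁻¹ • ∑ m ∈ s, (x - v m) := by
    rw [Finset.sum_sub_distrib, Finset.sum_const, smul_sub, ← Nat.cast_smul_eq_nsmul ℝ,
      inv_smul_smul₀ hc.ne']
  have h2 : ‖∑ m ∈ s, (x - v m)‖ ^ 2 ≤ s.card * ∑ m ∈ s, ‖x - v m‖ ^ 2 :=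
    (pow_le_pow_left₀ (norm_nonneg _) (norm_sum_le _ _) 2).trans sq_sum_le_card_mul_sum_sq
  rw [h1, norm_smul, mul_pow, norm_inv, Real.norm_of_nonneg hc.le]
  calc _ ≤ ((s.card : ℝ)⁻¹) ^ 2 * (s.card * ∑ m ∈ s, ‖x - v m‖ ^ 2) := by gcongr
    _ = _ := by field_simp

/-- The pairs `(i, j)` with `|i - j| ≤ L`, grouped by the shift `l = |i - j|`. The shift `0` and the
order of the pair are dealt with by the vanishing of `φ` on the diagonal and by its symmetry. -/
theorem sum_close_pairs_le (φ : ℕ → ℕ → ℝ) (hφ : ∀ i j, 0 ≤ φ i j) (hsymm : ∀ i j, φ i j = φ j i)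
    (hdiag : ∀ i, φ i i = 0) (N L : ℕ) :
    ∑ i ∈ Finset.range N, ∑ j ∈ Finset.range N, (if j ≤ i + L ∧ i ≤ j + L then φ i j else 0)
      ≤ 2 * ∑ l ∈ Finset.Icc 1 L, ∑ i ∈ Finset.range (N - l), φ (i + l) i := by
  have key : ∀ l, ∑ i ∈ Finset.range N, ∑ j ∈ Finset.range N, (if j = i + l then φ i j else 0)
      = ∑ i ∈ Finset.range (N - l), φ (i + l) i := by
    intro l
    have h : ∀ i ∈ Finset.range N, ∑ j ∈ Finset.range N, (if j = i + l then φ i j else 0)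
        = if i + l < N then φ (i + l) i else 0 := by
      intro i _
      rw [Finset.sum_ite_eq' (Finset.range N) (i + l) (fun j => φ i j)]
      simp [hsymm i (i + l)]
    rw [Finset.sum_congr rfl h, ← Finset.sum_filter]
    congr 1
    ext i
    simp only [Finset.mem_filter, Finset.mem_range]
    omega
  have hpt : ∀ i j, (if j ≤ i + L ∧ i ≤ j + L then φ i j else 0)
      ≤ ∑ l ∈ Finset.Icc 1 L, ((if j = i + l then φ i j else 0)
        + (if i = j + l then φ j i else 0)) := by
    intro i j
    have hnn : ∀ l ∈ Finset.Icc 1 L, 0 ≤ ((if j = i + l then φ i j else 0)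
        + (if i = j + l then φ j i else 0)) := by
      intro l _
      have := hφ i j
      have := hφ j i
      split_ifs <;> positivity
    split_ifs with h
    · rcases lt_trichotomy i j with hij | rfl | hij
      · refine le_trans ?_ (Finset.single_le_sum hnn (a := j - i) (by simp; omega))
        rw [if_pos (by omega), if_neg (by omega), add_zero]
      · rw [hdiag]
        exact Finset.sum_nonneg (by simp)
      · refine le_trans ?_ (Finset.single_le_sum hnn (a := i - j) (by simp; omega))
        rw [if_neg (by omega), if_pos (by omega), zero_add, hsymm]
    · exact Finset.sum_nonneg hnn
  calc _ ≤ ∑ i ∈ Finset.range N, ∑ j ∈ Finset.range N, ∑ l ∈ Finset.Icc 1 L,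
        ((if j = i + l then φ i j else 0) + (if i = j + l then φ j i else 0)) :=
        Finset.sum_le_sum fun i _ => Finset.sum_le_sum fun j _ => hpt i j
    _ = ∑ l ∈ Finset.Icc 1 L,
        (∑ i ∈ Finset.range N, ∑ j ∈ Finset.range N, (if j = i + l then φ i j else 0)
        + ∑ i ∈ Finset.range N, ∑ j ∈ Finset.range N, (if i = j + l then φ j i else 0)) := by
        simp_rw [← Finset.sum_add_distrib]
        rw [Finset.sum_comm' (t' := Finset.Icc 1 L) (s' := fun _ => Finset.range N)
          (by intros; tauto) |>.symm]
        refine Finset.sum_congr rfl fun i _ => ?_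
        rw [Finset.sum_comm]
    _ = _ := by
        rw [Finset.mul_sum]
        refine Finset.sum_congr rfl fun l _ => ?_
        rw [Finset.sum_comm (f := fun i j => if i = j + l then φ j i else 0), key, two_mul]

/-- On a grid of `N * K` cells, the sequence `m ↦ y (m / K)` is constant on groups of `K` cells; its
averages over the `K` consecutive blocks of `N` cells approximate it as well as its shifts by at most
`L` groups do. The condition on `L` makes it cover all pairs of cells of one block. -/
theorem sum_sq_sub_blockAvg_le {H : Type*} [NormedAddCommGroup H] [NormedSpace ℝ H]
    (y : ℕ → H) (N K L : ℕ) (hN : 0 < N) (hK : 0 < K) (hL : N ≤ K * L) :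
    ∑ m ∈ Finset.range (N * K), ‖y (m / K) - (N : ℝ)⁻¹ •
        ∑ m' ∈ Finset.Ico (N * (m / N)) (N * (m / N) + N), y (m' / K)‖ ^ 2
      ≤ (N : ℝ)⁻¹ * (K * (K * (2 * ∑ l ∈ Finset.Icc 1 L,
        ∑ i ∈ Finset.range (N - l), ‖y (i + l) - y i‖ ^ 2))) := by
  set φ : ℕ → ℕ → ℝ := fun i j => ‖y i - y j‖ ^ 2 with hφ
  set ψ : ℕ → ℕ → ℝ := fun i j => if j ≤ i + L ∧ i ≤ j + L then φ i j else 0 with hψ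
  have hψ0 : ∀ i j, 0 ≤ ψ i j := by
    intro i j
    simp only [hψ, hφ]
    split_ifs <;> positivity
  have h1 : ∀ m ∈ Finset.range (N * K), ‖y (m / K) - (N : ℝ)⁻¹ •
        ∑ m' ∈ Finset.Ico (N * (m / N)) (N * (m / N) + N), y (m' / K)‖ ^ 2
      ≤ (N : ℝ)⁻¹ * (K * ∑ j ∈ Finset.range N, ψ (m / K) j) := by
    intro m hm
    have hm := Finset.mem_range.1 hm
    set k := m / N with hk
    have hkK : k < K := Nat.div_lt_of_lt_mul hm
    have hm1 : N * k ≤ m := Nat.mul_div_le m N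
    have hm2 : m < N * k + N := by
      have := Nat.lt_mul_div_succ m hN
      rwa [mul_add, mul_one] at this
    have hcard : (Finset.Ico (N * k) (N * k + N)).card = N := by simp
    have := norm_sub_avg_sq_le (Finset.Ico (N * k) (N * k + N))
      (Finset.nonempty_Ico.2 (by omega)) (fun m' => y (m' / K)) (y (m / K))
    rw [hcard] at this
    refine this.trans ?_
    gcongr
    rw [← sum_range_mul_div N K hK]
    have hclose : ∀ p q, p < q + N → p / K ≤ q / K + L := by
      intro p q hpq
      have : p / K ≤ (q + K * L) / K := Nat.div_le_div_right (by omega)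
      rwa [Nat.add_mul_div_left _ _ hK] at this
    calc _ = ∑ m' ∈ Finset.Ico (N * k) (N * k + N), ψ (m / K) (m' / K) := by
          refine Finset.sum_congr rfl fun m' hm' => ?_
          rw [Finset.mem_Ico] at hm'
          simp only [hψ]
          rw [if_pos ⟨hclose _ _ (by omega), hclose _ _ (by omega)⟩]
      _ ≤ _ := by
          refine Finset.sum_le_sum_of_subset_of_nonneg ?_ fun i _ _ => hψ0 _ _
          intro m' hm'
          rw [Finset.mem_Ico] at hm'
          rw [Finset.mem_range]
          have : N * (k + 1) ≤ N * K := Nat.mul_le_mul_left _ hkK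
          rw [mul_add, mul_one] at this
          omega
  refine (Finset.sum_le_sum h1).trans ?_
  rw [← Finset.mul_sum, ← Finset.mul_sum,
    sum_range_mul_div N K hK (fun i => ∑ j ∈ Finset.range N, ψ i j)]
  gcongr
  exact sum_close_pairs_le φ (fun i j => by positivity) (fun i j => by simp [hφ, norm_sub_rev])
    (fun i => by simp [hφ]) N L

/-! ### Step functions on uniform grids -/

/-- The norm of a step function on the uniform grid with `M` cells. -/
theorem norm_sq_of_step {T : ℝ} (hT : 0 < T) {H : Type*} [NormedAddCommGroup H]
    (F : BochnerL2 T H) (M : ℕ) (hM : 0 < M) (f : ℕ → H)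
    (hF : ∀ m < M, ∀ᵐ t ∂(volume.restrict (Ioo (0 : ℝ) T)),
      t ∈ Ioc (m * (T / M)) ((m + 1) * (T / M)) → F t = f m) :
    ‖F‖ ^ 2 = ∑ m ∈ Finset.range M, ‖f m‖ ^ 2 * (T / M) := by
  have hMT : (0 : ℝ) < T / M := by positivity
  have hMT' : (M : ℝ) * (T / M) = T := by field_simp
  have h0 : ‖F‖ ^ 2 = ∫ t in Ioo (0 : ℝ) T, ‖F t‖ ^ 2 := by
    have h := (Lp.memLp F).eLpNorm_eq_integral_rpow_norm (by norm_num) (by norm_num)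
    rw [Lp.norm_def, h, ENNReal.toReal_ofReal (by positivity)]
    simp only [ENNReal.toReal_ofNat, Real.rpow_ofNat]
    rw [← Real.rpow_natCast, ← Real.rpow_mul (by positivity)]
    norm_num
  have hint : IntegrableOn (fun t => ‖F t‖ ^ 2) (Ioo (0 : ℝ) T) :=
    (Lp.memLp F).integrable_norm_pow (by norm_num)
  have hF' : ∀ m < M, ∀ᵐ t, t ∈ Ioc (m * (T / M)) ((m + 1) * (T / M)) → ‖F t‖ ^ 2 = ‖f m‖ ^ 2 := by
    intro m hm
    have h1 := (ae_restrict_iff' measurableSet_Ioo).1 (hF m hm)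
    have h2 : ∀ᵐ t : ℝ, t ≠ T := by simp [ae_iff, measure_singleton]
    filter_upwards [h1, h2] with t ht htT hmem
    rw [ht ⟨lt_of_le_of_lt (by positivity) hmem.1, lt_of_le_of_ne ?_ htT⟩ hmem]
    refine hmem.2.trans (le_trans ?_ hMT'.le)
    gcongr
    exact_mod_cast hm
  rw [h0, ← integral_Ioc_eq_integral_Ioo, ← intervalIntegral.integral_of_le hT.le]
  have hsub : ∀ m < M, IntervalIntegrable (fun t => ‖F t‖ ^ 2) volume
      (((m : ℕ) : ℝ) * (T / M)) (((m + 1 : ℕ) : ℝ) * (T / M)) := by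
    intro m hm
    rw [intervalIntegrable_iff_integrableOn_Ioc_of_le (by gcongr; simp)]
    rw [← integrableOn_Ioc_iff_integrableOn_Ioo] at hint
    refine hint.mono_set (Ioc_subset_Ioc (by positivity) ?_)
    refine le_trans ?_ hMT'.le
    gcongr
    exact_mod_cast hm
  have hadd := intervalIntegral.sum_integral_adjacent_intervals
    (a := fun m : ℕ => (m : ℝ) * (T / M)) hsub
  simp only [Nat.cast_zero, zero_mul, hMT'] at hadd
  rw [← hadd]
  refine Finset.sum_congr rfl fun m hm => ?_
  have hm := Finset.mem_range.1 hm
  rw [intervalIntegral.integral_congr_ae (g := fun _ => ‖f m‖ ^ 2)]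
  · rw [intervalIntegral.integral_const]
    push_cast
    simp only [smul_eq_mul]
    ring
  · rw [uIoc_of_le (by gcongr; simp)]
    push_cast
    exact hF' m hm

/-- The step function in `L²(0,T;H)` on the uniform grid with `K` cells `(k T/K, (k+1) T/K]` that
takes the value `a k` in the cell number `k`, counted from `0`. The values `a k` with `K ≤ k` are
ignored. -/
noncomputable def stepLp {H : Type*} [NormedAddCommGroup H] (T : ℝ) (K : ℕ) (a : ℕ → H) :
    BochnerL2 T H :=
  ∑ k ∈ Finset.range K, indicatorConstLp 2
    (measurableSet_Ioc (a := (k : ℝ) * (T / K)) (b := ((k : ℝ) + 1) * (T / K)))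
    (measure_ne_top _ _) (a k)

theorem continuous_stepLp {H : Type*} [NormedAddCommGroup H] (T : ℝ) (K : ℕ) :
    Continuous (stepLp T K : (ℕ → H) → BochnerL2 T H) := by
  refine continuous_finsetSum _ fun k _ => ?_
  have hlip : ∀ (s : Set ℝ) (hs : MeasurableSet s)
      (hμ : (volume.restrict (Ioo (0 : ℝ) T)) s ≠ ∞),
      Continuous (fun c : H => indicatorConstLp 2 hs hμ c) := by
    intro s hs hμ
    refine (LipschitzWith.of_dist_le_mul
      (K := ((volume.restrict (Ioo (0 : ℝ) T)).real s ^ (1 / (2 : ℝ≥0∞).toReal)).toNNReal)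
      fun c c' => ?_).continuous
    rw [dist_eq_norm, dist_eq_norm, indicatorConstLp_sub, mul_comm,
      Real.coe_toNNReal _ (by positivity)]
    exact norm_indicatorConstLp_le
  exact (hlip _ measurableSet_Ioc (measure_ne_top _ _)).comp (continuous_apply k)

theorem stepLp_ae_eq {H : Type*} [NormedAddCommGroup H] {T : ℝ} (hT : 0 < T) (K : ℕ) (a : ℕ → H)
    {k : ℕ} (hk : k < K) :
    ∀ᵐ t ∂(volume.restrict (Ioo (0 : ℝ) T)),
      t ∈ Ioc (k * (T / K)) ((k + 1) * (T / K)) → stepLp T K a t = a k := by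
  have hTK : 0 < T / K := div_pos hT (by exact_mod_cast (by omega : 0 < K))
  have hsum := Lp.coeFn_finsetSum (Finset.range K) (fun k => indicatorConstLp 2
    (measurableSet_Ioc (a := (k : ℝ) * (T / K)) (b := ((k : ℝ) + 1) * (T / K)))
    (measure_ne_top (volume.restrict (Ioo (0 : ℝ) T)) _) (a k))
  have hall : ∀ᵐ t ∂(volume.restrict (Ioo (0 : ℝ) T)), ∀ j : ℕ, indicatorConstLp 2
    (measurableSet_Ioc (a := (j : ℝ) * (T / K)) (b := ((j : ℝ) + 1) * (T / K)))
    (measure_ne_top (volume.restrict (Ioo (0 : ℝ) T)) _) (a j) t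
      = (Ioc ((j : ℝ) * (T / K)) (((j : ℝ) + 1) * (T / K))).indicator (fun _ => a j) t :=
    ae_all_iff.2 fun j => indicatorConstLp_coeFn
  filter_upwards [hsum, hall] with t h1 h2 ht
  rw [stepLp, h1, Finset.sum_apply, Finset.sum_eq_single_of_mem k (Finset.mem_range.2 hk)]
  · rw [h2, indicator_of_mem ht]
  · intro j _ hjk
    rw [h2, indicator_of_notMem]
    rintro ⟨hj1, hj2⟩
    have e1 := lt_of_mul_lt_mul_right (hj1.trans_le ht.2) hTK.le
    have e2 := lt_of_mul_lt_mul_right (ht.1.trans_le hj2) hTK.le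
    norm_cast at e1 e2
    omega

/-- The cell `m` of the grid with `N * K` cells lies in the cell `m / K` of the grid with `N` cells. -/
theorem mem_Ioc_coarse {T : ℝ} (hT : 0 < T) {N K : ℕ} (hN : 0 < N) (hK : 0 < K) {m : ℕ} {t : ℝ}
    (ht : t ∈ Ioc (m * (T / (N * K : ℕ))) ((m + 1) * (T / (N * K : ℕ)))) :
    t ∈ Ioc ((m / K : ℕ) * (T / N)) (((m / K : ℕ) + 1) * (T / N)) := by
  have hTN : T / N = K * (T / (N * K : ℕ)) := by
    push_cast
    field_simp
  have h0 : (0 : ℝ) < T / (N * K : ℕ) := by positivity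
  have h1 : ((m / K : ℕ) : ℝ) * K ≤ m := by exact_mod_cast Nat.div_mul_le_self m K
  have h2 : (m + 1 : ℝ) ≤ ((m / K : ℕ) + 1) * K := by
    exact_mod_cast (Nat.div_lt_iff_lt_mul hK).1 (Nat.lt_succ_self (m / K))
  rw [hTN, ← mul_assoc, ← mul_assoc]
  exact ⟨lt_of_le_of_lt (by gcongr) ht.1, ht.2.trans (by gcongr)⟩

/-! ### Relative compactness from translates -/

theorem totallyBounded_of_approx_isCompact {X : Type*} [PseudoMetricSpace X] {S : Set X}
    (h : ∀ ε > 0, ∃ 𝒦 : Set X, IsCompact 𝒦 ∧ ∀ f ∈ S, ∃ k ∈ 𝒦, dist f k < ε) :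
    TotallyBounded S := by
  rw [Metric.totallyBounded_iff]
  intro ε hε
  obtain ⟨𝒦, h𝒦, hS⟩ := h (ε / 2) (half_pos hε)
  obtain ⟨t, ht, hcov⟩ := Metric.totallyBounded_iff.1 h𝒦.totallyBounded (ε / 2) (half_pos hε)
  refine ⟨t, ht, fun f hf => ?_⟩
  obtain ⟨k, hk, hfk⟩ := hS f hf
  obtain ⟨y, hy, hky⟩ := mem_iUnion₂.1 (hcov hk)
  refine mem_iUnion₂.2 ⟨y, hy, ?_⟩
  rw [Metric.mem_ball] at hky ⊢
  linarith [dist_triangle f k y]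

/-- A discrete Kolmogorov–Simon criterion: a family of step functions, one for each uniform grid, that
is bounded in `L²(0,T;V)` with `V` compactly mapped to `H`, and whose translates by small multiples of
the step converge uniformly in `L²(0,T;H)`, is relatively compact in `L²(0,T;H)`. -/
theorem isCompact_closure_of_sum_translate_le {T : ℝ} (hT : 0 < T) {V H : Type*}
    [NormedAddCommGroup V] [NormedSpace ℝ V]
    [NormedAddCommGroup H] [NormedSpace ℝ H] [CompleteSpace H]
    (ι : V →L[ℝ] H) (hιc : IsCompactOperator ι) (x : ℕ → ℕ → V) (U : ℕ → BochnerL2 T H)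
    (hU : ∀ N i : ℕ, i < N → ∀ᵐ t ∂(volume.restrict (Ioo (0 : ℝ) T)),
      t ∈ Ioc (i * (T / N)) ((i + 1) * (T / N)) → U N t = ι (x N i))
    (hbdd : ∃ C, ∀ N : ℕ, 1 ≤ N → ∑ i ∈ Finset.range N, ‖x N i‖ ^ 2 * (T / N) ≤ C)
    (htr : ∀ ε > 0, ∃ ρ > 0, ∀ N l : ℕ, 1 ≤ l → l < N → l * (T / N) < ρ →
      ∑ i ∈ Finset.range (N - l), ‖ι (x N (i + l)) - ι (x N i)‖ ^ 2 * (T / N) ≤ ε) :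
    IsCompact (closure {f : BochnerL2 T H | ∃ N : ℕ, 1 ≤ N ∧ f = U N}) := by
  refine TotallyBounded.isCompact_of_isClosed (TotallyBounded.closure ?_) isClosed_closure
  refine totallyBounded_of_approx_isCompact fun ε hε => ?_
  obtain ⟨C, hC⟩ := hbdd
  obtain ⟨ρ, hρ, htr⟩ := htr (ε ^ 2 / 16) (by positivity)
  obtain ⟨K, hK⟩ := exists_nat_gt (2 * T / ρ)
  have hK0 : 0 < K := by
    have : (0 : ℝ) < K := lt_of_le_of_lt (by positivity) hK
    exact_mod_cast this
  set B : Set H := closure (ι '' Metric.closedBall 0 (Real.sqrt (K * C / T))) with hB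
  have hBc : IsCompact B := hιc.isCompact_closure_image_closedBall (𝕜₁ := ℝ) _
  refine ⟨stepLp T K '' (Set.univ.pi fun _ => B) ∪ U '' (Iio K),
    ((isCompact_univ_pi fun _ => hBc).image (continuous_stepLp T K)).union
      ((finite_Iio K).image U).isCompact, ?_⟩
  rintro f ⟨N, hN, rfl⟩
  -- With `N ≥ K` the shifts, of length at most `T / K + T / N`, stay below `ρ`.
  rcases lt_or_ge N K with hNK | hNK
  · exact ⟨U N, Or.inr ⟨N, hNK, rfl⟩, by simpa using hε⟩
  have hN' : (0 : ℝ) < N := by exact_mod_cast hN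
  have hK' : (0 : ℝ) < K := by exact_mod_cast hK0
  -- The averages over the coarse cells, computed on the common refinement of the two grids.
  set b : ℕ → V := fun k => (N : ℝ)⁻¹ • ∑ m ∈ Finset.Ico (N * k) (N * k + N), x N (m / K) with hb
  have hb_norm : ∀ k < K, ‖b k‖ ≤ Real.sqrt (K * C / T) := by
    intro k hk
    refine Real.le_sqrt_of_sq_le ?_
    have h := norm_sub_avg_sq_le (Finset.Ico (N * k) (N * k + N))
      (Finset.nonempty_Ico.2 (by omega)) (fun m' => x N (m' / K)) 0
    simp only [zero_sub, norm_neg, Nat.card_Ico, add_tsub_cancel_left] at h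
    refine h.trans ?_
    have h2 : ∑ m ∈ Finset.Ico (N * k) (N * k + N), ‖x N (m / K)‖ ^ 2
        ≤ ∑ m ∈ Finset.range (N * K), ‖x N (m / K)‖ ^ 2 := by
      refine Finset.sum_le_sum_of_subset_of_nonneg ?_ fun i _ _ => by positivity
      intro m' hm'
      rw [Finset.mem_Ico] at hm'
      rw [Finset.mem_range]
      have : N * (k + 1) ≤ N * K := Nat.mul_le_mul_left _ hk
      rw [mul_add, mul_one] at this
      omega
    rw [sum_range_mul_div N K hK0 (fun i => ‖x N i‖ ^ 2)] at h2
    have h3 := hC N hN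
    rw [← Finset.sum_mul, ← le_div_iff₀ (by positivity)] at h3
    calc _ ≤ (N : ℝ)⁻¹ * (K * (C / (T / N))) := by gcongr; exact h2.trans (by gcongr)
      _ = _ := by field_simp
  set a : ℕ → H := fun k => if k < K then ι (b k) else 0 with ha
  refine ⟨stepLp T K a, Or.inl ⟨a, fun k _ => ?_, rfl⟩, ?_⟩
  · simp only [ha]
    split_ifs with hk
    · exact subset_closure ⟨b k, by simpa using hb_norm k hk, rfl⟩
    · exact subset_closure ⟨0, by simp, map_zero ι⟩
  -- On the common refinement, the cell `m` lies in the cell `m / K` of the grid with `N` cells and in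
  -- the cell `m / N` of the grid with `K` cells.
  have hstep : ‖U N - stepLp T K a‖ ^ 2 = ∑ m ∈ Finset.range (N * K),
      ‖ι (x N (m / K)) - a (m / N)‖ ^ 2 * (T / (N * K : ℕ)) := by
    refine norm_sq_of_step hT _ (N * K) (by positivity) _ fun m hm => ?_
    filter_upwards [Lp.coeFn_sub (U N) (stepLp T K a), hU N (m / K)
      (Nat.div_lt_of_lt_mul (by rwa [mul_comm])), stepLp_ae_eq hT K a
      (Nat.div_lt_of_lt_mul hm : m / N < K)] with t h1 h2 h3 ht
    rw [h1, Pi.sub_apply, h2 (mem_Ioc_coarse hT hN hK0 ht),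
      h3 (mem_Ioc_coarse hT hK0 hN (by rwa [mul_comm K N]))]
  have hsq : ‖U N - stepLp T K a‖ ^ 2 ≤ (ε / 2) ^ 2 := by
    rw [hstep, ← Finset.sum_mul]
    set L := N / K + 1 with hL
    have hmain := sum_sq_sub_blockAvg_le (fun i => ι (x N i)) N K L hN hK0
      (Nat.lt_mul_div_succ N hK0).le
    have hLK : (L : ℝ) * K ≤ N + K := by
      have : L * K ≤ N + K := by
        rw [hL, add_mul, one_mul]
        exact Nat.add_le_add_right (Nat.div_mul_le_self N K) K
      exact_mod_cast this
    have hNK' : (K : ℝ) ≤ N := by exact_mod_cast hNK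
    have htrl : ∀ l ∈ Finset.Icc 1 L, ∑ i ∈ Finset.range (N - l),
        ‖ι (x N (i + l)) - ι (x N i)‖ ^ 2 ≤ ε ^ 2 / 16 / (T / N) := by
      intro l hl
      rw [Finset.mem_Icc] at hl
      rcases lt_or_ge l N with hlN | hlN
      · rw [le_div_iff₀ (by positivity), Finset.sum_mul]
        refine htr N l hl.1 hlN ?_
        have hlL : (l : ℝ) ≤ L := by exact_mod_cast hl.2
        rw [div_lt_iff₀ hρ] at hK
        have h1 : (l : ℝ) * (T / N) * (K * N) ≤ 2 * T * N := by
          have h2 : (l : ℝ) * K ≤ 2 * N := by nlinarith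
          calc _ = (l * K) * T := by field_simp
            _ ≤ (2 * N) * T := by gcongr
            _ = _ := by ring
        have h4 : 2 * T * N < (K * ρ) * N := by gcongr
        refine lt_of_mul_lt_mul_right (a := (K : ℝ) * N) (h1.trans_lt ?_) (by positivity)
        linarith
      -- The largest shifts may exceed the number of cells; their sums are empty.
      · rw [Nat.sub_eq_zero_of_le hlN]
        simp only [Finset.range_zero, Finset.sum_empty]
        positivity
    have hsum := Finset.sum_le_sum htrl
    rw [Finset.sum_const, Nat.card_Icc, add_tsub_cancel_right, nsmul_eq_mul] at hsum
    have hrew : ∑ m ∈ Finset.range (N * K), ‖ι (x N (m / K)) - a (m / N)‖ ^ 2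
        = ∑ m ∈ Finset.range (N * K), ‖ι (x N (m / K)) - (N : ℝ)⁻¹ •
        ∑ m' ∈ Finset.Ico (N * (m / N)) (N * (m / N) + N), ι (x N (m' / K))‖ ^ 2 := by
      refine Finset.sum_congr rfl fun m hm => ?_
      simp only [ha, hb]
      rw [if_pos (Nat.div_lt_of_lt_mul (Finset.mem_range.1 hm)), map_smul, map_sum]
    rw [hrew]
    calc _ ≤ (N : ℝ)⁻¹ * (K * (K * (2 * (L * (ε ^ 2 / 16 / (T / N)))))) * (T / (N * K : ℕ)) := by
          gcongr
          refine hmain.trans ?_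
          gcongr
      _ = (L * K) * (ε ^ 2 / 8) / N := by
          push_cast
          field_simp
          ring
      _ ≤ (2 * N) * (ε ^ 2 / 8) / N := by
          gcongr ?_ * (ε ^ 2 / 8) / (N : ℝ)
          linarith
      _ = (ε / 2) ^ 2 := by
          field_simp
          ring
  rw [dist_eq_norm]
  have := abs_le_of_sq_le_sq hsq (by positivity)
  rw [abs_norm] at this
  linarith

/-! ### Dual norms and projections -/

section dual
variable {Q H : Type*} [NormedAddCommGroup Q] [NormedSpace ℝ Q]
    [NormedAddCommGroup H] [InnerProductSpace ℝ H]

theorem inner_le_dualNorm_mul (j : Q →L[ℝ] H) (w : H) (q : Q) :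
    inner ℝ w (j q) ≤ dualNorm j w * ‖q‖ :=
  (le_abs_self _).trans (((innerSL ℝ w).comp j).le_opNorm q)

/-- A one-sided bound on the action suffices: apply it to `-q` as well. -/
theorem dualNorm_le_of_inner_le (j : Q →L[ℝ] H) (w : H) {c : ℝ} (hc : 0 ≤ c)
    (h : ∀ q, inner ℝ w (j q) ≤ c * ‖q‖) : dualNorm j w ≤ c := by
  refine ContinuousLinearMap.opNorm_le_bound _ hc fun q => abs_le.2 ⟨?_, h q⟩
  have h' := h (-q)
  rw [map_neg, inner_neg_right, norm_neg] at h'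
  exact neg_le.1 h'

/-- Projecting `w` does not change its action on `Q`, so that the bound on the dual norm of the
projected increments controls the increments themselves when they are tested with `Q`. -/
theorem inner_projOnClosure_left [CompleteSpace H] (j : Q →L[ℝ] H) (w : H) (q : Q) :
    inner ℝ (projOnClosure j w) (j q) = inner ℝ w (j q) := by
  have h := Submodule.starProjection_inner_eq_zero
    (K := (LinearMap.range (j : Q →ₗ[ℝ] H)).topologicalClosure) w (j q)
    (Submodule.le_topologicalClosure _ (LinearMap.mem_range_self (j : Q →ₗ[ℝ] H) q))
  rw [inner_sub_left, sub_eq_zero] at h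
  exact h.symm
end dual

/-! ### Estimates for time translates -/

theorem sum_shift_le_sum_Icc {f : ℕ → ℝ} (hf : ∀ n, 0 ≤ f n) {n l N : ℕ} (h : n + l ≤ N) :
    ∑ j ∈ Finset.range l, f (n + j + 1) ≤ ∑ i ∈ Finset.Icc 1 N, f i := by
  have := Finset.sum_Ico_eq_sum_range f (n + 1) (n + 1 + l)
  rw [add_tsub_cancel_left] at this
  calc _ = ∑ i ∈ Finset.Ico (n + 1) (n + 1 + l), f i := by
        rw [this]
        exact Finset.sum_congr rfl fun j _ => by rw [add_right_comm]
    _ ≤ _ := by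
        refine Finset.sum_le_sum_of_subset_of_nonneg (fun i hi => ?_) fun i _ _ => hf i
        rw [Finset.mem_Ico] at hi
        rw [Finset.mem_Icc]
        omega

/-- The Cauchy–Schwarz inequality in time. -/
theorem sum_mul_le_sqrt_mul_sqrt {f : ℕ → ℝ} {l : ℕ} {τ A : ℝ} (hτ : 0 ≤ τ)
    (hA : ∑ j ∈ Finset.range l, f j ^ 2 * τ ≤ A) :
    ∑ j ∈ Finset.range l, f j * τ ≤ Real.sqrt A * Real.sqrt (l * τ) := by
  rw [← Real.sqrt_mul' _ (by positivity)]
  refine Real.le_sqrt_of_sq_le ?_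
  rw [← Finset.sum_mul] at hA ⊢
  have h := sq_sum_le_card_mul_sum_sq (s := Finset.range l) (f := f)
  rw [Finset.card_range] at h
  calc _ = (∑ j ∈ Finset.range l, f j) ^ 2 * τ ^ 2 := by ring
    _ ≤ (l * ∑ j ∈ Finset.range l, f j ^ 2) * τ ^ 2 := by gcongr
    _ = ((∑ j ∈ Finset.range l, f j ^ 2) * τ) * (l * τ) := by ring
    _ ≤ _ := by gcongr

/-- The increment `y l - y 0` tested with a fixed `q`, when the single increments can only be tested
with approximations `p j` of `q`: summation by parts. Here `τ` is the time step, and the bound is of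
the order of the square root of the time shift `l τ`. -/
theorem inner_sub_le_of_increments {H : Type*} [NormedAddCommGroup H] [InnerProductSpace ℝ H]
    (y p : ℕ → H) (q : H) (a : ℕ → ℝ) (l : ℕ) {τ r c₁ c₂ c₃ c₄ A T : ℝ}
    (hτ : 0 ≤ τ) (hr : 0 ≤ r) (hc₁ : 0 ≤ c₁) (hc₂ : 0 ≤ c₂)
    (hp : ∀ j < l, inner ℝ (p (j + 1) - p j) (y (j + 1)) ≤ c₁ * τ * r * a (j + 1))
    (hy : ∀ j < l, inner ℝ (y (j + 1) - y j) (p j) ≤ c₂ * τ * r * (a (j + 1) + 1))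
    (hq : ∀ i ≤ l, ‖p i - q‖ ≤ c₃ * Real.sqrt (l * τ) * r)
    (hy' : ∀ i ≤ l, ‖y i‖ ≤ c₄)
    (hA : ∑ j ∈ Finset.range l, a (j + 1) ^ 2 * τ ≤ A) (hT : l * τ ≤ T) :
    inner ℝ (y l - y 0) q ≤
      ((c₁ + c₂) * Real.sqrt A + c₂ * Real.sqrt T + 2 * (c₃ * c₄)) * Real.sqrt (l * τ) * r := by
  have hlτ : 0 ≤ l * τ := by positivity
  have htel : inner ℝ (y l - y 0) q = inner ℝ (y 0) (p 0 - q) - inner ℝ (y l) (p l - q)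
      + ∑ j ∈ Finset.range l, (inner ℝ (p (j + 1) - p j) (y (j + 1))
        + inner ℝ (y (j + 1) - y j) (p j)) := by
    have h : ∀ j ∈ Finset.range l, inner ℝ (p (j + 1) - p j) (y (j + 1))
        + inner ℝ (y (j + 1) - y j) (p j)
        = (inner ℝ (y (j + 1)) (p (j + 1)) : ℝ) - inner ℝ (y j) (p j) := by
      intro j _
      rw [real_inner_comm, inner_sub_right, inner_sub_left]
      ring
    rw [Finset.sum_congr rfl h, Finset.sum_range_sub (fun j => (inner ℝ (y j) (p j) : ℝ)),
      inner_sub_left, inner_sub_right, inner_sub_right]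
    ring
  have hend : ∀ i ≤ l, |inner ℝ (y i) (p i - q)| ≤ c₄ * (c₃ * Real.sqrt (l * τ) * r) := by
    intro i hi
    exact (abs_real_inner_le_norm _ _).trans
      (mul_le_mul (hy' i hi) (hq i hi) (norm_nonneg _) ((norm_nonneg _).trans (hy' i hi)))
  have h0 := (abs_le.1 (hend 0 (Nat.zero_le l))).2
  have h1 := (abs_le.1 (hend l le_rfl)).1
  have hsum : ∑ j ∈ Finset.range l, (inner ℝ (p (j + 1) - p j) (y (j + 1))
        + inner ℝ (y (j + 1) - y j) (p j))
      ≤ ((c₁ + c₂) * ∑ j ∈ Finset.range l, a (j + 1) * τ + c₂ * (l * τ)) * r := by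
    calc _ ≤ ∑ j ∈ Finset.range l, ((c₁ + c₂) * r * (a (j + 1) * τ) + c₂ * r * τ) := by
          refine Finset.sum_le_sum fun j hj => ?_
          have hj := Finset.mem_range.1 hj
          linarith [hp j hj, hy j hj]
      _ = _ := by
          rw [Finset.sum_add_distrib, ← Finset.mul_sum, Finset.sum_const, Finset.card_range,
            nsmul_eq_mul]
          ring
  have hcs := sum_mul_le_sqrt_mul_sqrt (f := fun j => a (j + 1)) hτ hA
  have hlτ' : l * τ ≤ Real.sqrt T * Real.sqrt (l * τ) := by
    calc l * τ = Real.sqrt (l * τ) * Real.sqrt (l * τ) := (Real.mul_self_sqrt hlτ).symm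
      _ ≤ _ := by gcongr
  have hfin : ((c₁ + c₂) * ∑ j ∈ Finset.range l, a (j + 1) * τ + c₂ * (l * τ)) * r
      ≤ ((c₁ + c₂) * (Real.sqrt A * Real.sqrt (l * τ))
        + c₂ * (Real.sqrt T * Real.sqrt (l * τ))) * r := by gcongr
  rw [htel]
  linarith

/-- A value that is taken on a nondegenerate interval obeys the essential bound. -/
theorem norm_le_of_step_of_eLpNorm_top_le {T : ℝ} {H : Type*} [NormedAddCommGroup H]
    (F : BochnerL2 T H) {C s t : ℝ} (hC : 0 ≤ C) (hs : 0 ≤ s) (hst : s < t) (ht : t ≤ T) {z : H}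
    (hF : eLpNorm F ∞ (volume.restrict (Ioo (0 : ℝ) T)) ≤ ENNReal.ofReal C)
    (hz : ∀ᵐ r ∂(volume.restrict (Ioo (0 : ℝ) T)), r ∈ Ioc s t → F r = z) : ‖z‖ ≤ C := by
  by_contra hlt
  have h1 : ∀ᵐ r ∂(volume.restrict (Ioo (0 : ℝ) T)), r ∉ Ioo s t := by
    rw [eLpNorm_exponent_top] at hF
    filter_upwards [hz, enorm_ae_le_eLpNormEssSup F (volume.restrict (Ioo (0 : ℝ) T))]
      with r hr1 hr2 hr3
    have h := hr2.trans hF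
    rw [hr1 ⟨hr3.1, hr3.2.le⟩, ← ofReal_norm, ENNReal.ofReal_le_ofReal_iff hC] at h
    exact hlt h
  have h2 : volume.restrict (Ioo (0 : ℝ) T) (Ioo s t) = 0 := by
    have h := ae_iff.1 h1
    simp only [not_not] at h
    exact h
  rw [Measure.restrict_eq_self _ (Ioo_subset_Ioo hs ht), Real.volume_Ioo,
    ENNReal.ofReal_eq_zero] at h2
  linarith

theorem sum_sq_norm_sub_le {H : Type*} [NormedAddCommGroup H] (y : ℕ → H) (a : ℕ → ℝ) (l m : ℕ)
    {α β τ A T : ℝ} (hτ : 0 ≤ τ)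
    (h : ∀ i < m, ‖y (i + l) - y i‖ ≤ α * (a (i + l) + a i) + β)
    (hA : ∑ i ∈ Finset.range m, a i ^ 2 * τ ≤ A)
    (hAl : ∑ i ∈ Finset.range m, a (i + l) ^ 2 * τ ≤ A) (hT : m * τ ≤ T) :
    ∑ i ∈ Finset.range m, ‖y (i + l) - y i‖ ^ 2 * τ ≤ 8 * A * α ^ 2 + 2 * T * β ^ 2 := by
  have hsq : ∀ b b' : ℝ,
      (α * (b + b') + β) ^ 2 ≤ 4 * α ^ 2 * b ^ 2 + 4 * α ^ 2 * b' ^ 2 + 2 * β ^ 2 := by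
    intro b b'
    have e : 4 * α ^ 2 * b ^ 2 + 4 * α ^ 2 * b' ^ 2 + 2 * β ^ 2 - (α * (b + b') + β) ^ 2
        = (α * (b + b') - β) ^ 2 + 2 * (α * (b - b')) ^ 2 := by ring
    have : 0 ≤ (α * (b + b') - β) ^ 2 + 2 * (α * (b - b')) ^ 2 := by positivity
    linarith
  calc _ ≤ ∑ i ∈ Finset.range m, (4 * α ^ 2 * (a (i + l) ^ 2 * τ) + 4 * α ^ 2 * (a i ^ 2 * τ)
          + 2 * β ^ 2 * τ) := by
        refine Finset.sum_le_sum fun i hi => ?_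
        have h1 := pow_le_pow_left₀ (norm_nonneg _) (h i (Finset.mem_range.1 hi)) 2
        have h2 := mul_le_mul_of_nonneg_right (h1.trans (hsq _ _)) hτ
        linarith
    _ = 4 * α ^ 2 * ∑ i ∈ Finset.range m, a (i + l) ^ 2 * τ
          + 4 * α ^ 2 * ∑ i ∈ Finset.range m, a i ^ 2 * τ + 2 * β ^ 2 * (m * τ) := by
        rw [Finset.sum_add_distrib, Finset.sum_add_distrib, ← Finset.mul_sum, ← Finset.mul_sum,
          Finset.sum_const, Finset.card_range, nsmul_eq_mul]
        ring
    _ ≤ 4 * α ^ 2 * A + 4 * α ^ 2 * A + 2 * β ^ 2 * T := by gcongr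
    _ = _ := by ring

/-! ### The compactness theorem -/

/-- The time step is `Δt = T / N`. The spaces `V^n_Δt`, `Q^n_Δt`, `Q^{n,l}_Δt` are `Vn N n`,
`Qn N n`, `Qnl N n l`, with embeddings `eV`, `eQ`, `eQl` into `V`; `ι` embeds `V` into `H`.
Only the indices `1 ≤ n ≤ N` (and `1 ≤ l`, `n + l ≤ N`) matter. -/
theorem theorem2
    {T : ℝ} (hT : 0 < T)
    -- the Hilbert spaces `V` and `H`, with `V` compactly embedded in `H`
    {V H : Type*}
    [NormedAddCommGroup V] [InnerProductSpace ℝ V] [CompleteSpace V]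
    [NormedAddCommGroup H] [InnerProductSpace ℝ H] [CompleteSpace H]
    (ι : V →L[ℝ] H) (hι : Function.Injective ι) (hιc : IsCompactOperator ι)
    -- the Hilbert spaces `V^n_Δt` and `Q^n_Δt`, uniformly continuously embedded in `V`
    {Vn : ℕ → ℕ → Type*}
    [∀ N n, NormedAddCommGroup (Vn N n)] [∀ N n, InnerProductSpace ℝ (Vn N n)]
    [∀ N n, CompleteSpace (Vn N n)]
    {Qn : ℕ → ℕ → Type*}
    [∀ N n, NormedAddCommGroup (Qn N n)] [∀ N n, InnerProductSpace ℝ (Qn N n)]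
    [∀ N n, CompleteSpace (Qn N n)]
    (eV : ∀ N n, Vn N n →L[ℝ] V) (eQ : ∀ N n, Qn N n →L[ℝ] V)
    (heV : ∀ N n : ℕ, 1 ≤ n → n ≤ N → Function.Injective (eV N n))
    (heQ : ∀ N n : ℕ, 1 ≤ n → n ≤ N → Function.Injective (eQ N n))
    (hunif : ∃ C > 0, ∀ N n : ℕ, 1 ≤ n → n ≤ N →
      (∀ v, ‖eV N n v‖ ≤ C * ‖v‖) ∧ (∀ q, ‖eQ N n q‖ ≤ C * ‖q‖))
    -- `V^n_Δt` is contained in the closure of `Q^n_Δt` in `H`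
    -- (compactly so, because it is continuously embedded in `V`)
    (hVQ : ∀ N n : ℕ, 1 ≤ n → n ≤ N → ∀ v, ι (eV N n v) ∈ closureIn (ι.comp (eQ N n)))
    -- the functions `u^n_Δt` in `V^n_Δt` and the piecewise constant `u_Δt` in `L²(0,T;H)`
    (u : ∀ N n, Vn N n)
    (U : ℕ → BochnerL2 T H)
    (hU : ∀ N n : ℕ, 1 ≤ n → n ≤ N → ∀ᵐ t ∂(volume.restrict (Ioo (0 : ℝ) T)),
      t ∈ Ioc (((n : ℝ) - 1) * (T / N)) (n * (T / N)) → U N t = ι (eV N n (u N n)))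
    -- (A1)
    (hA1 : ∃ C > 0, ∀ N : ℕ, 1 ≤ N → ∑ n ∈ Finset.Icc 1 N, ‖u N n‖ ^ 2 * (T / N) ≤ C)
    -- (A2)
    (hA2 : ∃ C > 0, ∀ N : ℕ, 1 ≤ N →
      eLpNorm (U N) ∞ (volume.restrict (Ioo (0 : ℝ) T)) ≤ ENNReal.ofReal C)
    -- (B)
    (hB : ∃ C > 0, ∀ N n : ℕ, 1 ≤ n → n + 1 ≤ N →
      dualNorm (ι.comp (eQ N n)) (projOnClosure (ι.comp (eQ N n))
        ((T / N)⁻¹ • (ι (eV N (n + 1) (u N (n + 1))) - ι (eV N n (u N n)))))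
      ≤ C * (‖u N (n + 1)‖ + 1))
    -- the common test spaces `Q^{n,l}_Δt`, contained in `V`
    {Qnl : ℕ → ℕ → ℕ → Type*}
    [∀ N n l, NormedAddCommGroup (Qnl N n l)] [∀ N n l, NormedSpace ℝ (Qnl N n l)]
    (eQl : ∀ N n l, Qnl N n l →L[ℝ] V)
    (heQl : ∀ N n l : ℕ, 1 ≤ l → 1 ≤ n → n + l ≤ N → Function.Injective (eQl N n l))
    -- (C1)
    (J : ∀ N n l i, Qnl N n l → Qn N (n + i))
    (hC1 : ∃ C > 0, ∀ N n l : ℕ, 1 ≤ l → 1 ≤ n → n + l ≤ N → ∀ q : Qnl N n l,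
      (∀ i ≤ l, ‖J N n l i q‖ ≤ C * ‖q‖) ∧
      (∀ j < l,
        inner ℝ (ι (eQ N (n + (j + 1)) (J N n l (j + 1) q)) - ι (eQ N (n + j) (J N n l j q)))
            (ι (eV N (n + j + 1) (u N (n + j + 1))))
          ≤ C * (T / N) * ‖q‖ * ‖u N (n + j + 1)‖) ∧
      (∀ i ≤ l, ‖ι (eQ N (n + i) (J N n l i q)) - ι (eQl N n l q)‖
          ≤ C * Real.sqrt (l * (T / N)) * ‖q‖))
    -- (C2), where `V^{n,l}_Δt` is the closure of `Q^{n,l}_Δt` in `V`, with the norm of `V`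
    (I : ∀ N n l i, Vn N (n + i) → closureIn (eQl N n l))
    (hC21 : ∃ C > 0, ∀ N n l : ℕ, 1 ≤ l → 1 ≤ n → n + l ≤ N → ∀ i ≤ l, ∀ v : Vn N (n + i),
      ‖I N n l i v‖ ≤ C * ‖v‖)
    (g : ℝ → ℝ) (hg0 : ∀ h > 0, 0 ≤ g h) (hgmono : MonotoneOn g (Ioi 0))
    (hglim : Tendsto g (𝓝[>] 0) (𝓝 0))
    (hC22 : ∀ N n l : ℕ, 1 ≤ l → 1 ≤ n → n + l ≤ N → ∀ i ≤ l, ∀ v : Vn N (n + i),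
      ‖ι (I N n l i v : V) - ι (eV N (n + i) v)‖ ≤ g (l * (T / N)) * ‖v‖)
    -- (C3), the uniform Ehrling property
    (hC3 : ∀ δ > 0, ∃ Cδ > 0, ∀ N n l : ℕ, 1 ≤ l → 1 ≤ n → n + l ≤ N →
      ∀ v : closureIn (eQl N n l),
        ‖ι (v : V)‖ ≤ δ * ‖v‖ + Cδ * dualNorm (ι.comp (eQl N n l)) (ι (v : V))) :
    -- the family of all `u_Δt` is relatively compact in `L²(0,T;H)`
    IsCompact (closure {f : BochnerL2 T H | ∃ N : ℕ, 1 ≤ N ∧ f = U N}) := by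
  obtain ⟨Cu, hCu, hunif⟩ := hunif
  obtain ⟨A, hA0, hA1⟩ := hA1
  obtain ⟨C₂, hC₂, hA2⟩ := hA2
  obtain ⟨CB, hCB, hB⟩ := hB
  obtain ⟨C₁, hC₁, hC1⟩ := hC1
  obtain ⟨CI, hCI, hC21⟩ := hC21
  set y : ℕ → ℕ → H := fun N n => ι (eV N n (u N n)) with hy
  set a : ℕ → ℕ → ℝ := fun N n => ‖u N n‖ with ha
  have ha0 : ∀ N n, 0 ≤ a N n := fun N n => norm_nonneg _
  have hyC : ∀ N n : ℕ, 1 ≤ n → n ≤ N → ‖y N n‖ ≤ C₂ := by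
    intro N n hn hnN
    have hN : (0 : ℝ) < N := by exact_mod_cast (by omega : 0 < N)
    have hn' : (1 : ℝ) ≤ n := by exact_mod_cast hn
    have hnN' : (n : ℝ) ≤ N := by exact_mod_cast hnN
    have hτ : 0 < T / N := by positivity
    refine norm_le_of_step_of_eLpNorm_top_le (U N) hC₂.le (mul_nonneg (by linarith) hτ.le)
      (by gcongr; linarith) ?_ (hA2 N (by omega)) (hU N n hn hnN)
    calc (n : ℝ) * (T / N) ≤ N * (T / N) := by gcongr
      _ = T := by field_simp
  have hAsum : ∀ N n l : ℕ, 1 ≤ N → n + l ≤ N →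
      ∑ j ∈ Finset.range l, a N (n + j + 1) ^ 2 * (T / N) ≤ A := fun N n l hN h =>
    (sum_shift_le_sum_Icc (f := fun n => a N n ^ 2 * (T / N))
      (fun n => by positivity) h).trans (hA1 N hN)
  have hlT : ∀ N l : ℕ, 1 ≤ N → l ≤ N → (l : ℝ) * (T / N) ≤ T := by
    intro N l hN hl
    have hN : (0 : ℝ) < N := by exact_mod_cast hN
    calc (l : ℝ) * (T / N) ≤ N * (T / N) := by gcongr
      _ = T := by field_simp
  -- The embeddings of the test spaces into `H` are uniformly bounded, by `hC1` and the bound on `eQ`.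
  set E : ℝ := ‖ι‖ * (Cu * C₁) + C₁ * Real.sqrt T with hE
  have hE0 : 0 ≤ E := by positivity
  have hqE : ∀ N n l : ℕ, 1 ≤ l → 1 ≤ n → n + l ≤ N → ∀ q : Qnl N n l,
      ‖ι (eQl N n l q)‖ ≤ E * ‖q‖ := by
    intro N n l hl hn hnl q
    obtain ⟨h1, -, h3⟩ := hC1 N n l hl hn hnl q
    have h4 := h3 0 (Nat.zero_le l)
    have h5 : ‖ι (eQ N (n + 0) (J N n l 0 q))‖ ≤ ‖ι‖ * (Cu * (C₁ * ‖q‖)) := by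
      refine (ι.le_opNorm _).trans ?_
      gcongr
      exact ((hunif N (n + 0) hn (by omega)).2 _).trans (by gcongr; exact h1 0 (Nat.zero_le l))
    have h6 : Real.sqrt (l * (T / N)) ≤ Real.sqrt T :=
      Real.sqrt_le_sqrt (hlT N l (by omega) (by omega))
    calc _ ≤ ‖ι (eQ N (n + 0) (J N n l 0 q))‖
          + ‖ι (eQ N (n + 0) (J N n l 0 q)) - ι (eQl N n l q)‖ := by
          exact norm_le_norm_add_norm_sub _ _
      _ ≤ ‖ι‖ * (Cu * (C₁ * ‖q‖)) + C₁ * Real.sqrt T * ‖q‖ :=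
          add_le_add h5 (h4.trans (by gcongr))
      _ = _ := by
          rw [hE]
          ring
  set M : ℝ := (C₁ + CB * C₁) * Real.sqrt A + CB * C₁ * Real.sqrt T + 2 * (C₁ * C₂) with hM
  have hM0 : 0 ≤ M := by positivity
  have hweak : ∀ N n l : ℕ, 1 ≤ l → 1 ≤ n → n + l ≤ N → ∀ q : Qnl N n l,
      inner ℝ (y N (n + l) - y N n) (ι (eQl N n l q)) ≤ M * Real.sqrt (l * (T / N)) * ‖q‖ := by
    intro N n l hl hn hnl q
    obtain ⟨h1, h2, h3⟩ := hC1 N n l hl hn hnl q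
    have hN : (0 : ℝ) < N := by exact_mod_cast (by omega : 0 < N)
    have hτ : 0 < T / N := by positivity
    refine inner_sub_le_of_increments (fun j => y N (n + j))
      (fun j => ι (eQ N (n + j) (J N n l j q))) (ι (eQl N n l q)) (fun j => a N (n + j)) l
      hτ.le (norm_nonneg q) hC₁.le (by positivity) (fun j hj => h2 j hj) (fun j hj => ?_) h3
      (fun i hi => hyC N (n + i) (by omega) (by omega)) (hAsum N n l (by omega) hnl)
      (hlT N l (by omega) (by omega))
    -- The increment acts on `J^j q ∈ Q^{n+j}` as its projection does
    have h4 := inner_le_dualNorm_mul (ι.comp (eQ N (n + j))) (projOnClosure (ι.comp (eQ N (n + j)))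
        ((T / N)⁻¹ • (y N (n + j + 1) - y N (n + j)))) (J N n l j q)
    rw [inner_projOnClosure_left, real_inner_smul_left, inv_mul_le_iff₀ hτ] at h4
    refine h4.trans ?_
    have h5 := hB N (n + j) (by omega) (by omega)
    calc _ ≤ T / N * (CB * (a N (n + j + 1) + 1) * (C₁ * ‖q‖)) := by
          have := ha0 N (n + j + 1)
          gcongr
          exact h1 j hj.le
      _ = CB * C₁ * (T / N) * ‖q‖ * (a N (n + j + 1) + 1) := by ring
  have hstrong : ∀ δ > 0, ∃ Cδ > 0, ∀ N n l : ℕ, 1 ≤ l → 1 ≤ n → n + l ≤ N →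
      ‖y N (n + l) - y N n‖ ≤ ((1 + Cδ * E) * g (l * (T / N)) + δ * CI) * (a N (n + l) + a N n)
        + Cδ * (M * Real.sqrt (l * (T / N))) := by
    intro δ hδ
    obtain ⟨Cδ, hCδ, hC3⟩ := hC3 δ hδ
    refine ⟨Cδ, hCδ, fun N n l hl hn hnl => ?_⟩
    have hN : (0 : ℝ) < N := by exact_mod_cast (by omega : 0 < N)
    have hl' : (0 : ℝ) < l := by exact_mod_cast hl
    have hg : 0 ≤ g (l * (T / N)) := hg0 _ (by positivity)
    set v : closureIn (eQl N n l) := I N n l l (u N (n + l)) - I N n l 0 (u N n) with hv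
    set s := a N (n + l) + a N n with hs
    have hs0 : 0 ≤ s := add_nonneg (ha0 _ _) (ha0 _ _)
    have hvn : ‖v‖ ≤ CI * s := by
      rw [hs, mul_add]
      exact (norm_sub_le _ _).trans (add_le_add (hC21 N n l hl hn hnl l le_rfl _)
        (hC21 N n l hl hn hnl 0 (Nat.zero_le l) _))
    have hvy : ‖ι (v : V) - (y N (n + l) - y N n)‖ ≤ g (l * (T / N)) * s := by
      have h : ι (v : V) - (y N (n + l) - y N n)
          = (ι (I N n l l (u N (n + l)) : V) - ι (eV N (n + l) (u N (n + l))))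
            - (ι (I N n l 0 (u N n) : V) - ι (eV N (n + 0) (u N n))) := by
        rw [hv, Submodule.coe_sub, map_sub]
        simp only [hy]
        abel
      rw [h, hs, mul_add]
      exact (norm_sub_le _ _).trans (add_le_add (hC22 N n l hl hn hnl l le_rfl _)
        (hC22 N n l hl hn hnl 0 (Nat.zero_le l) _))
    have hdual : dualNorm (ι.comp (eQl N n l)) (ι (v : V))
        ≤ g (l * (T / N)) * s * E + M * Real.sqrt (l * (T / N)) := by
      refine dualNorm_le_of_inner_le _ _ (by positivity) fun q => ?_
      have h1 := hweak N n l hl hn hnl q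
      have h2 : inner ℝ (ι (v : V) - (y N (n + l) - y N n)) (ι (eQl N n l q))
          ≤ g (l * (T / N)) * s * (E * ‖q‖) :=
        (real_inner_le_norm _ _).trans (mul_le_mul hvy (hqE N n l hl hn hnl q) (norm_nonneg _)
          (by positivity))
      rw [inner_sub_left] at h2
      rw [ContinuousLinearMap.comp_apply]
      linarith
    have htri : ‖y N (n + l) - y N n‖
        ≤ ‖ι (v : V)‖ + ‖ι (v : V) - (y N (n + l) - y N n)‖ :=
      norm_le_norm_add_norm_sub _ _
    have h3 := hC3 N n l hl hn hnl v
    have h4 : δ * ‖v‖ ≤ δ * (CI * s) := by gcongr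
    have h5 : Cδ * dualNorm (ι.comp (eQl N n l)) (ι (v : V))
        ≤ Cδ * (g (l * (T / N)) * s * E + M * Real.sqrt (l * (T / N))) := by gcongr
    linarith
  refine isCompact_closure_of_sum_translate_le hT ι hιc (fun N i => eV N (i + 1) (u N (i + 1))) U
    (fun N i hi => ?_) ⟨Cu ^ 2 * A, fun N hN => ?_⟩ fun ε hε => ?_
  · simpa using hU N (i + 1) (by omega) (by omega)
  · have hN' : (0 : ℝ) < N := by exact_mod_cast hN
    have h := hAsum N 0 N hN (by omega)
    simp only [zero_add] at h
    refine le_trans ?_ (mul_le_mul_of_nonneg_left h (by positivity))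
    rw [Finset.mul_sum]
    refine Finset.sum_le_sum fun i hi => ?_
    have h1 := (hunif N (i + 1) (by omega) (by simpa using hi)).1 (u N (i + 1))
    rw [← mul_assoc, ← mul_pow]
    gcongr
  · -- `δ` is chosen first, so that the limit of the bound as the time shift tends to `0` is below `ε`.
    obtain ⟨δ, hδ, hδε⟩ : ∃ δ > 0, 8 * A * (δ * CI) ^ 2 < ε := by
      have hc : Tendsto (fun δ : ℝ => 8 * A * (δ * CI) ^ 2) (𝓝[>] 0) (𝓝 0) := by
        have : Continuous (fun δ : ℝ => 8 * A * (δ * CI) ^ 2) := by fun_prop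
        simpa using (this.tendsto 0).mono_left nhdsWithin_le_nhds
      obtain ⟨δ, h1, h2⟩ := ((hc.eventually (gt_mem_nhds hε)).and self_mem_nhdsWithin).exists
      exact ⟨δ, h2, h1⟩
    obtain ⟨Cδ, hCδ, hstrong⟩ := hstrong δ hδ
    have hlim : Tendsto (fun h : ℝ => 8 * A * ((1 + Cδ * E) * g h + δ * CI) ^ 2
        + 2 * T * (Cδ * (M * Real.sqrt h)) ^ 2) (𝓝[>] 0) (𝓝 (8 * A * (δ * CI) ^ 2)) := by
      have hs : Tendsto Real.sqrt (𝓝[>] 0) (𝓝 0) := by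
        simpa using (Real.continuous_sqrt.tendsto 0).mono_left nhdsWithin_le_nhds
      have h := ((((hglim.const_mul (1 + Cδ * E)).add_const (δ * CI)).pow 2).const_mul (8 * A)).add
        ((((hs.const_mul M).const_mul Cδ).pow 2).const_mul (2 * T))
      simpa using h
    obtain ⟨ρ, hρ, hρε⟩ := mem_nhdsGT_iff_exists_Ioo_subset.1 (hlim.eventually (gt_mem_nhds hδε))
    refine ⟨ρ, hρ, fun N l hl hlN hlρ => ?_⟩
    have hN : (0 : ℝ) < N := by exact_mod_cast (by omega : 0 < N)
    have hl' : (0 : ℝ) < l := by exact_mod_cast hl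
    have hτ : 0 < T / N := by positivity
    have hε' := hρε ⟨by positivity, hlρ⟩
    refine (sum_sq_norm_sub_le (fun i => y N (i + 1)) (fun i => a N (i + 1)) l (N - l)
      (A := A) (T := T) hτ.le (fun i hi => ?_) ?_ ?_ (hlT N (N - l) (by omega) (by omega))).trans
      (le_of_lt hε')
    · rw [add_right_comm i l 1]
      exact hstrong N (i + 1) l hl (by omega) (by omega)
    · simpa only [zero_add] using hAsum N 0 (N - l) (by omega) (by omega)
    · simpa only [add_comm l] using hAsum N l (N - l) (by omega) (by omega)
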